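/- Let $I$ be a Polish space with its Borel $\sigma$-algebra, let $H$ be a non-atomic probability measure on $I$, let $P_0$ be a discrete probability measure on $I$ (that is, $P_0$ is carried by a countable set), and write $P_0^\infty$ for the law of an i.i.d. sequence $X_1, X_2, \dots$ with common law $P_0$. For $0 \le \alpha < 1$ and $\theta > -\alpha$ let $\Pi_{\alpha,\theta}$ be the law of the two-parameter Poisson–Dirichlet process $$P_{\alpha,\theta} = \sum_{k=1}^\infty V_k \prod_{j=1}^{k-1} (1 - V_j)\, \delta_{Z_k},$$ where the $V_k \sim \mathrm{beta}(1-\alpha, \theta + k\alpha)$ are independent and, independently of them, the $Z_k$ are i.i.d. with law $H$. For observations $X_1, \dots, X_n$ let $Y_1, \dots, Y_{n(\mathbf p)}$ be their distinct values, with multiplicities $e_1, \dots, e_{n(\mathbf p)}$. The posterior distribution $\Pi^{(n)}_{\alpha,\theta}$ is the law, for given $X_1, \dots, X_n$ with $n \ge 1$, of the random probability measure $$P^{(n)}_{\alpha,\theta} = R\, P_{\alpha, \theta + n(\mathbf p)\alpha} + (1 - R) \sum_{j=1}^{n(\mathbf p)} \Delta_j\, \delta_{Y_j},$$ where $P_{\alpha,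 \theta + n(\mathbf p)\alpha} \sim \Pi_{\alpha, \theta + n(\mathbf p)\alpha}$, $R \sim \mathrm{beta}(\theta + n(\mathbf p)\alpha,\, n - n(\mathbf p)\alpha)$ and $(\Delta_1, \dots, \Delta_{n(\mathbf p)}) \sim \mathrm{Dirichlet}(e_1 - \alpha, \dots, e_{n(\mathbf p)} - \alpha)$ are independent. **Proposition 2.2.** Suppose that $P_0$ is discrete and that $n(\mathbf p)/n \to 0$ as $n \to \infty$, $P_0^\infty$-almost surely. Then for all $0 \le \alpha < 1$ and $\theta > -\alpha$, for $P_0^\infty$-almost every sequence $X_1, X_2, \dots$, the posterior distribution $\Pi^{(n)}_{\alpha,\theta}$ converges weakly, as $n \to \infty$, to the point mass at $P_0$; here $\Pi^{(n)}_{\alpha,\theta}$ is a probability measure on the space of probability measures on $I$, which carries the topology of weak convergence. -/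

import Mathlib

open MeasureTheory ProbabilityTheory Filter Topology
open scoped NNReal ENNReal

namespace PoissonDirichlet

section WeakTopology

variable {E : Type*} [TopologicalSpace E] [SecondCountableTopology E]
  [TopologicalSpace.PseudoMetrizableSpace E] [MeasurableSpace E] [BorelSpace E]

/-- On a separable metrizable space, the sets that are open for the topology of weak convergence
are measurable for the σ-algebra generated by the evaluations `P ↦ P A`. Hence laws of random
probability measures live on the Borel sets of the weak topology. -/
instance instOpensMeasurableSpaceProbabilityMeasure :
    OpensMeasurableSpace (ProbabilityMeasure E) := by
  classical
  let B : Set (Set E) := TopologicalSpace.countableBasis E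
  have hB : B.Countable := TopologicalSpace.countable_countableBasis E
  let T : Set (Finset (Set E)) := {t | ∀ u ∈ t, u ∈ B}
  have hT : T.Countable := by
    have h : ((fun t : Finset (Set E) => (t : Set (Set E))) '' T).Countable := by
      refine (Set.countable_ofPred_finite_subset hB).mono ?_
      rintro _ ⟨t, ht, rfl⟩
      exact ⟨t.finite_toSet, fun u hu => ht u hu⟩
    exact Set.countable_of_injective_of_countable_image Finset.coe_injective.injOn h
  let S : Set (Set (ProbabilityMeasure E)) :=
    (fun p : Finset (Set E) × ℚ => {μ | (p.2 : ℝ) < μ (⋃ u ∈ p.1, u)}) '' (T ×ˢ Set.univ)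
  have hS : S.Countable := (hT.prod Set.countable_univ).image _
  have hopen : ∀ t ∈ T, IsOpen (⋃ u ∈ t, u) := fun t ht =>
    isOpen_biUnion fun u hu => TopologicalSpace.isOpen_of_mem_countableBasis (ht u hu)
  have hle : TopologicalSpace.generateFrom S ≤
      (inferInstance : TopologicalSpace (ProbabilityMeasure E)) := by
    refine le_of_nhds_le_nhds fun μ => ?_
    let L : Filter (ProbabilityMeasure E) := @nhds _ (TopologicalSpace.generateFrom S) μ
    have hL : L.IsCountablyGenerated := by
      let _ : TopologicalSpace (ProbabilityMeasure E) := TopologicalSpace.generateFrom S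
      have : SecondCountableTopology (ProbabilityMeasure E) := ⟨S, hS, rfl⟩
      exact (inferInstance : (𝓝 μ).IsCountablyGenerated)
    refine tendsto_of_forall_isOpen_le_liminf (L := L) (μs := fun ν => ν) fun G hG => ?_
    refine le_of_forall_lt fun r hr => ?_
    obtain ⟨r', hrr', hr'⟩ := exists_between hr
    obtain ⟨t, htB, hlt, htG⟩ := ProbabilityMeasure.exists_lt_measure_biUnion_of_isOpen (S := B) μ
      (fun u hu x hx => by
        obtain ⟨v, hv, hxv, hvu⟩ :=
          (TopologicalSpace.isBasis_countableBasis E).exists_subset_of_mem_open hx hu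
        exact ⟨v, hv, (TopologicalSpace.isOpen_of_mem_countableBasis hv).mem_nhds hxv, hvu⟩)
      hG hr'
    obtain ⟨q, hq1, hq2⟩ := exists_rat_btwn (NNReal.coe_lt_coe.2 hlt)
    refine hrr'.trans_le ?_
    refine le_liminf_of_le ?_ ?_
    · exact isBoundedUnder_of ⟨1, by simp⟩ |>.isCoboundedUnder_ge
    · have hmem : {ν : ProbabilityMeasure E | (q : ℝ) < ν (⋃ u ∈ t, u)} ∈ S :=
        ⟨(t, q), ⟨htB, trivial⟩, rfl⟩
      have ho : {ν : ProbabilityMeasure E | (q : ℝ) < ν (⋃ u ∈ t, u)} ∈ L :=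
        @IsOpen.mem_nhds _ (TopologicalSpace.generateFrom S) _ _
          (TopologicalSpace.isOpen_generateFrom_of_mem hmem) hq2
      filter_upwards [ho] with ν hν
      have h1 : (r' : ℝ) < ν (⋃ u ∈ t, u) := hq1.trans hν
      exact (NNReal.coe_lt_coe.1 h1).le.trans (ν.apply_mono htG)
  constructor
  refine (borel_anti hle).trans ?_
  have hborel : @borel _ (TopologicalSpace.generateFrom S) = MeasurableSpace.generateFrom S :=
    @borel_eq_generateFrom_of_subbasis _ S (TopologicalSpace.generateFrom S)
      (@SecondCountableTopology.mk _ (TopologicalSpace.generateFrom S) ⟨S, hS, rfl⟩) rfl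
  rw [hborel]
  refine MeasurableSpace.generateFrom_le ?_
  rintro _ ⟨⟨t, q⟩, ⟨ht, -⟩, rfl⟩
  have hm : Measurable fun μ : ProbabilityMeasure E => (μ : Measure E) (⋃ u ∈ t, u) :=
    (Measure.measurable_coe (hopen t ht).measurableSet).comp measurable_subtype_coe
  exact measurableSet_lt measurable_const hm.ennreal_toReal

end WeakTopology

noncomputable section

/-- The beta(`a`, `b`) law for `a, b > 0`. For other parameters (which occur below only before
the first observation) it is the point mass at `1`, the limit of beta(`a`, `b`) as `b → 0`. -/
def betaLaw (a b : ℝ) : ProbabilityMeasure ℝ :=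
  if h : 0 < a ∧ 0 < b then ⟨betaMeasure a b, isProbabilityMeasureBeta h.1 h.2⟩
  else ⟨Measure.dirac 1, inferInstance⟩

/-- The gamma(`a`, 1) law for `a > 0` (the point mass at `0` otherwise; never used). -/
def gammaLaw (a : ℝ) : ProbabilityMeasure ℝ :=
  if h : 0 < a then ⟨gammaMeasure a 1, isProbabilityMeasure_gammaMeasure h one_pos⟩
  else ⟨Measure.dirac 0, inferInstance⟩

/-- The Dirichlet law with parameters `a i > 0`: the law of `(G i / ∑ j, G j)` for independent
gamma(`a i`, 1) variables `G i`. -/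
def dirichletLaw {ι : Type*} [Fintype ι] (a : ι → ℝ) : ProbabilityMeasure (ι → ℝ) :=
  (ProbabilityMeasure.pi fun i => gammaLaw (a i)).map
    (f := fun g i => g i / ∑ j, g j) (by fun_prop)

variable {I : Type*} [MeasurableSpace I]

/-- A measure read as a probability measure, with the default value `H` if its total mass is
not one. -/
def toProb (H : ProbabilityMeasure I) (μ : Measure I) : ProbabilityMeasure I :=
  open Classical in
  if h : IsProbabilityMeasure μ then ⟨μ, h⟩ else H

lemma measurable_toProb (H : ProbabilityMeasure I) : Measurable (toProb H) := by
  classical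
  have hs : MeasurableSet {μ : Measure I | IsProbabilityMeasure μ} := by
    have : {μ : Measure I | IsProbabilityMeasure μ} = (fun μ : Measure I => μ Set.univ) ⁻¹' {1} := by
      ext μ
      exact isProbabilityMeasure_iff
    rw [this]
    exact Measure.measurable_coe MeasurableSet.univ (measurableSet_singleton 1)
  refine Measurable.subtype_mk (p := fun μ : Measure I => IsProbabilityMeasure μ)
    (f := fun μ => (toProb H μ : Measure I)) (h := fun μ => (toProb H μ).2) ?_
  have : (fun μ => (toProb H μ : Measure I)) =
      fun μ => if IsProbabilityMeasure μ then μ else (H : Measure I) := by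
    funext μ
    by_cases h : IsProbabilityMeasure μ <;> simp [toProb, h]
  rw [this]
  exact Measurable.ite hs measurable_id measurable_const

/-- The measure `∑ k, w k • δ_{z k}`. -/
def atomic {κ : Type*} (w : κ → ℝ) (z : κ → I) : Measure I :=
  Measure.sum fun k => ENNReal.ofReal (w k) • Measure.dirac (z k)

lemma measurable_atomic {Ω κ : Type*} [MeasurableSpace Ω] [Countable κ] {w : Ω → κ → ℝ}
    {z : Ω → κ → I} (hw : Measurable w) (hz : Measurable z) :
    Measurable fun ω => atomic (w ω) (z ω) := by
  refine Measure.measurable_of_measurable_coe _ fun s hs => ?_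
  simp only [atomic, Measure.sum_apply _ hs, Measure.smul_apply, smul_eq_mul]
  refine Measurable.tsum fun k => ?_
  refine Measurable.mul (by fun_prop) ?_
  exact (Measure.measurable_coe hs).comp (Measure.measurable_dirac.comp (by fun_prop))

/-- Stick-breaking weights `v k * ∏_{j < k} (1 - v j)`. -/
def stickWeight (v : ℕ → ℝ) (k : ℕ) : ℝ := v k * ∏ j ∈ Finset.range k, (1 - v j)

lemma measurable_stickWeight : Measurable stickWeight := by
  unfold stickWeight
  fun_prop

/-- The random measure `∑ k, V k ∏_{j < k} (1 - V j) δ_{Z k}` as a function of the sequences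
`V` and `Z`. -/
def stickBreaking (H : ProbabilityMeasure I) (p : (ℕ → ℝ) × (ℕ → I)) : ProbabilityMeasure I :=
  toProb H (atomic (stickWeight p.1) p.2)

lemma measurable_stickBreaking (H : ProbabilityMeasure I) : Measurable (stickBreaking H) := by
  exact (measurable_toProb H).comp
    (measurable_atomic (measurable_stickWeight.comp measurable_fst) measurable_snd)

/-- The law of an i.i.d. sequence with common law `P`. -/
def iidLaw (P : ProbabilityMeasure I) : ProbabilityMeasure (ℕ → I) :=
  ⟨Measure.infinitePi fun _ : ℕ => (P : Measure I), inferInstance⟩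

/-- The law of independent variables `V_1, V_2, …` with `V_k ∼ beta(1 - α, θ + k α)`; the variable
with index `k : ℕ` is `V_{k+1}`. -/
def stickLaw (α θ : ℝ) : ProbabilityMeasure (ℕ → ℝ) :=
  ⟨Measure.infinitePi fun k : ℕ => (betaLaw (1 - α) (θ + (k + 1) * α) : Measure ℝ), inferInstance⟩

/-- The law of the two-parameter (`α`, `θ`) Poisson–Dirichlet process with base law `H`.
(For `0 ≤ α < 1` and `θ > -α` the stick-breaking weights add up to one almost surely.) -/
def pdLaw (H : ProbabilityMeasure I) (α θ : ℝ) : ProbabilityMeasure (ProbabilityMeasure I) :=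
  ((stickLaw α θ).prod (iidLaw H)).map (measurable_stickBreaking H).aemeasurable

open Classical in
/-- The set of distinct values among the first `n` observations. -/
def distinctValues (x : ℕ → I) (n : ℕ) : Finset I := (Finset.range n).image x

/-- The number `n(𝐩)` of distinct values among the first `n` observations. -/
def numDistinct (x : ℕ → I) (n : ℕ) : ℕ := (distinctValues x n).card

open Classical in
/-- The number of the first `n` observations that are equal to `y`. -/
def multiplicity (x : ℕ → I) (n : ℕ) (y : I) : ℕ := ((Finset.range n).filter (x · = y)).card

/-- The random measure `R P + (1 - R) ∑_y Δ_y δ_y`, with `y` ranging over the finite set `Y`, as a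
function of `(P, R, Δ)`. -/
def posteriorMeasure (H : ProbabilityMeasure I) (Y : Finset I)
    (q : ProbabilityMeasure I × ℝ × (Y → ℝ)) : ProbabilityMeasure I :=
  toProb H (ENNReal.ofReal q.2.1 • (q.1 : Measure I) +
    ENNReal.ofReal (1 - q.2.1) • atomic q.2.2 (fun y : Y => (y : I)))

lemma measurable_posteriorMeasure (H : ProbabilityMeasure I) (Y : Finset I) :
    Measurable (posteriorMeasure H Y) := by
  have h1 : Measurable fun q : ProbabilityMeasure I × ℝ × (Y → ℝ) => (q.1 : Measure I) :=
    measurable_subtype_coe.comp measurable_fst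
  have h3 : Measurable fun q : ProbabilityMeasure I × ℝ × (Y → ℝ) =>
      atomic q.2.2 (fun y : Y => (y : I)) :=
    measurable_atomic measurable_snd.snd measurable_const
  have h4 : Measurable fun q : ProbabilityMeasure I × ℝ × (Y → ℝ) =>
      ENNReal.ofReal q.2.1 • (q.1 : Measure I) +
        ENNReal.ofReal (1 - q.2.1) • atomic q.2.2 (fun y : Y => (y : I)) := by
    refine Measure.measurable_of_measurable_coe _ fun s hs => ?_
    simp only [Measure.add_apply, Measure.smul_apply, smul_eq_mul]
    exact Measurable.add
      (Measurable.mul (by fun_prop) ((Measure.measurable_coe hs).comp h1))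
      (Measurable.mul (by fun_prop) ((Measure.measurable_coe hs).comp h3))
  exact (measurable_toProb H).comp h4

/-- The posterior law of the (`α`, `θ`) Poisson–Dirichlet prior given the first `n` terms of the
sequence of observations `x`: the law of `R P' + (1 - R) ∑_y Δ_y δ_y` where, with `m` the number of
distinct values among these observations and `e_y` the multiplicity of such a value `y`, the random
elements `P'`, `R`, `Δ` are independent, `P'` is an (`α`, `θ + m α`) Poisson–Dirichlet process,
`R ∼ beta(θ + m α, n - m α)` and `Δ ∼ Dirichlet(e_y - α)`. (For `n = 0` this is the prior.) -/
def posterior (H : ProbabilityMeasure I) (α θ : ℝ) (x : ℕ → I) (n : ℕ) :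
    ProbabilityMeasure (ProbabilityMeasure I) :=
  let m : ℝ := numDistinct x n
  ((pdLaw H α (θ + m * α)).prod
    ((betaLaw (θ + m * α) (n - m * α)).prod
      (dirichletLaw fun y : distinctValues x n => (multiplicity x n y : ℝ) - α))).map
    (measurable_posteriorMeasure H (distinctValues x n)).aemeasurable

end

end PoissonDirichlet

/-! ### Moments of beta and gamma laws. -/

namespace ProbabilityTheory

/-! Since `P₀` is carried by a countable set `S`, no mass can be lost: if `P {s}` tends to `P₀ {s}`
for every `s ∈ S`, then `P` tends weakly to `P₀` (`iInf_comap_singleton_le_nhds`). So it suffices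
that, for each `s ∈ S`, the posterior law of `P {s}` concentrates at `P₀ {s}`
(`tendsto_diracProba_of_forall_singleton`).

Under the posterior, `P {s} = R P' {s} + (1 - R) Δ_s`. With `m` distinct values, `R` has mean `(θ +
m α) / (θ + n)`, which tends to `0` because `m / n → 0`; by Markov the first term is negligible, and
of `P'` only `0 ≤ P' {s} ≤ 1` matters. The weight `Δ_s` has centre `(e_s - α) / (n - m α)`; writing
it as a ratio of gamma variables and applying Chebyshev to numerator and denominator gives deviation
probability `O(1 / (n - m α))` (`dirichletLaw_deviation_le`), and `n - m α ≥ (1 - α) n`. These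
bounds are combined in `posterior_deviation_le`.

Finally the centre tends to `P₀ {s}`, by the strong law for `e_s / n` and again `m / n → 0`
(`tendsto_discountedFrequency`). -/

lemma ae_betaMeasure (a b : ℝ) : ∀ᵐ x ∂betaMeasure a b, 0 < x ∧ x < 1 := by
  have hm : Measurable (betaPDF a b) := (measurable_betaPDFReal a b).ennreal_ofReal
  rw [betaMeasure, ae_withDensity_iff hm]
  refine ae_of_all _ fun x hx => ?_
  by_contra h
  exact hx (by rw [betaPDF_eq, if_neg h, ENNReal.ofReal_zero])

/-- Size biasing: the factor `x` raises the first exponent by one, and the ratio of normalizing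
constants follows from `Γ(t + 1) = t Γ(t)`. The mean then comes from the total mass of another beta
density. -/
lemma mul_betaPDFReal {a b : ℝ} (ha : 0 < a) (hb : 0 < b) (x : ℝ) :
    betaPDFReal a b x * x = a / (a + b) * betaPDFReal (a + 1) b x := by
  unfold betaPDFReal
  split_ifs with h
  · have hx : x ^ (a + 1 - 1) = x ^ (a - 1) * x := by
      rw [← Real.rpow_add_one h.1.ne']
      congr 1
      ring
    have hB : beta (a + 1) b = a / (a + b) * beta a b := by
      unfold beta
      rw [Real.Gamma_add_one ha.ne', show a + 1 + b = (a + b) + 1 by ring,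
        Real.Gamma_add_one (by positivity)]
      have := Real.Gamma_pos_of_pos (add_pos ha hb)
      field_simp
    have := beta_pos ha hb
    rw [hx, hB]
    field_simp
  · simp

lemma lintegral_ofReal_betaMeasure {a b : ℝ} (ha : 0 < a) (hb : 0 < b) :
    ∫⁻ x, ENNReal.ofReal x ∂betaMeasure a b = ENNReal.ofReal (a / (a + b)) := by
  have hm : ∀ c, Measurable (betaPDF c b) := fun c => (measurable_betaPDFReal c b).ennreal_ofReal
  rw [betaMeasure, lintegral_withDensity_eq_lintegral_mul _ (hm a) ENNReal.measurable_ofReal]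
  have : ∀ x, (betaPDF a b * fun x => ENNReal.ofReal x) x =
      ENNReal.ofReal (a / (a + b)) * betaPDF (a + 1) b x := fun x => by
    have h0 : 0 ≤ betaPDFReal a b x := by
      by_cases h : 0 < x ∧ x < 1
      · exact (betaPDFReal_pos h.1 h.2 ha hb).le
      · rw [betaPDFReal, if_neg h]
    rw [Pi.mul_apply, betaPDF, betaPDF, ← ENNReal.ofReal_mul h0, mul_betaPDFReal ha hb,
      ENNReal.ofReal_mul (by positivity)]
  simp_rw [this]
  rw [lintegral_const_mul _ (hm _), lintegral_betaPDF_eq_one (by positivity) hb, mul_one]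

lemma ae_gammaMeasure_pos (a r : ℝ) : ∀ᵐ x ∂gammaMeasure a r, 0 < x := by
  have hm : Measurable (gammaPDF a r) := (measurable_gammaPDFReal a r).ennreal_ofReal
  rw [gammaMeasure, ae_withDensity_iff hm]
  -- The density vanishes for negative arguments but possibly not at `0`, which is a Lebesgue null
  -- set.
  filter_upwards [Measure.ae_ne volume (0 : ℝ)] with x hx0 hx
  by_contra h
  exact hx (gammaPDF_of_neg (lt_of_le_of_ne (not_lt.1 h) hx0))

lemma mul_gammaPDFReal {a : ℝ} (ha : 0 < a) (x : ℝ) :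
    gammaPDFReal a 1 x * x = a * gammaPDFReal (a + 1) 1 x := by
  unfold gammaPDFReal
  split_ifs with h
  · have hx : x ^ (a + 1 - 1) = x ^ (a - 1) * x := by
      rcases h.eq_or_lt with rfl | h
      · simp [Real.zero_rpow ha.ne']
      · rw [← Real.rpow_add_one h.ne']
        congr 1
        ring
    have := Real.Gamma_pos_of_pos ha
    rw [hx, Real.Gamma_add_one ha.ne', Real.one_rpow, Real.one_rpow]
    field_simp
  · simp

/-- Size biasing for gamma laws. With `f = 1` it yields the mean, and with `f x = x` the second
moment. -/
lemma lintegral_ofReal_mul_gammaMeasure {a : ℝ} (ha : 0 < a) {f : ℝ → ℝ≥0∞}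
    (hf : Measurable f) :
    ∫⁻ x, ENNReal.ofReal x * f x ∂gammaMeasure a 1 =
      ENNReal.ofReal a * ∫⁻ x, f x ∂gammaMeasure (a + 1) 1 := by
  have hm : ∀ c, Measurable (gammaPDF c 1) := fun c => (measurable_gammaPDFReal c 1).ennreal_ofReal
  rw [gammaMeasure, lintegral_withDensity_eq_lintegral_mul (g := fun x => ENNReal.ofReal x * f x) _
    (hm a) (ENNReal.measurable_ofReal.mul hf), gammaMeasure,
    lintegral_withDensity_eq_lintegral_mul _ (hm _) hf, ← lintegral_const_mul _ ((hm _).mul hf)]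
  refine lintegral_congr fun x => ?_
  simp only [Pi.mul_apply]
  rw [← mul_assoc, ← mul_assoc, gammaPDF, gammaPDF,
    ← ENNReal.ofReal_mul (gammaPDFReal_nonneg ha one_pos x), mul_gammaPDFReal ha,
    ENNReal.ofReal_mul ha.le]

lemma lintegral_ofReal_gammaMeasure {a : ℝ} (ha : 0 < a) :
    ∫⁻ x, ENNReal.ofReal x ∂gammaMeasure a 1 = ENNReal.ofReal a := by
  have := isProbabilityMeasure_gammaMeasure (show 0 < a + 1 by positivity) one_pos
  simpa using lintegral_ofReal_mul_gammaMeasure ha (f := fun _ => 1) measurable_const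

lemma lintegral_ofReal_sq_gammaMeasure {a : ℝ} (ha : 0 < a) :
    ∫⁻ x, ENNReal.ofReal (x ^ 2) ∂gammaMeasure a 1 = ENNReal.ofReal (a * (a + 1)) := by
  rw [ENNReal.ofReal_mul ha.le, ← lintegral_ofReal_gammaMeasure (show 0 < a + 1 by positivity),
    ← lintegral_ofReal_mul_gammaMeasure ha ENNReal.measurable_ofReal]
  refine lintegral_congr_ae ?_
  filter_upwards [ae_gammaMeasure_pos a 1] with x hx
  rw [← ENNReal.ofReal_mul hx.le, sq]

lemma memLp_id_gammaMeasure {a : ℝ} (ha : 0 < a) : MemLp id 2 (gammaMeasure a 1) := by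
  rw [memLp_two_iff_integrable_sq (by fun_prop)]
  refine ⟨by fun_prop, ?_⟩
  rw [hasFiniteIntegral_iff_ofReal (ae_of_all _ fun x => sq_nonneg _)]
  simp only [id]
  rw [lintegral_ofReal_sq_gammaMeasure ha]
  exact ENNReal.ofReal_lt_top

lemma integral_id_gammaMeasure {a : ℝ} (ha : 0 < a) : ∫ x, x ∂gammaMeasure a 1 = a := by
  rw [integral_eq_lintegral_of_nonneg_ae _ (by fun_prop), lintegral_ofReal_gammaMeasure ha,
    ENNReal.toReal_ofReal ha.le]
  filter_upwards [ae_gammaMeasure_pos a 1] with x hx using hx.le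

lemma variance_id_gammaMeasure {a : ℝ} (ha : 0 < a) : Var[id; gammaMeasure a 1] = a := by
  have := isProbabilityMeasure_gammaMeasure ha one_pos
  rw [variance_eq_sub (memLp_id_gammaMeasure ha)]
  simp only [Pi.pow_apply, id]
  rw [integral_id_gammaMeasure ha, integral_eq_lintegral_of_nonneg_ae
    (ae_of_all _ fun x => sq_nonneg _) (by fun_prop), lintegral_ofReal_sq_gammaMeasure ha,
    ENNReal.toReal_ofReal (by positivity)]
  ring

end ProbabilityTheory

/-! ### Concentration of beta and Dirichlet laws. -/

namespace PoissonDirichlet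

lemma gammaLaw_toMeasure {a : ℝ} (ha : 0 < a) : (gammaLaw a : Measure ℝ) = gammaMeasure a 1 := by
  simp [gammaLaw, ha]

lemma betaLaw_toMeasure {a b : ℝ} (ha : 0 < a) (hb : 0 < b) :
    (betaLaw a b : Measure ℝ) = betaMeasure a b := by
  simp [betaLaw, ha, hb]

lemma betaLaw_ge_le {a b ε : ℝ} (ha : 0 < a) (hb : 0 < b) (hε : 0 < ε) :
    (betaLaw a b : Measure ℝ) {r | ε ≤ r} ≤ ENNReal.ofReal (a / (a + b) / ε) := by
  have h := meas_ge_le_lintegral_div (μ := betaMeasure a b) ENNReal.measurable_ofReal.aemeasurable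
    (ENNReal.ofReal_pos.2 hε).ne' ENNReal.ofReal_ne_top
  rw [lintegral_ofReal_betaMeasure ha hb, ← ENNReal.ofReal_div_of_pos hε] at h
  rw [betaLaw_toMeasure ha hb]
  exact (measure_mono fun r (hr : ε ≤ r) => ENNReal.ofReal_le_ofReal hr).trans h

section Gamma

variable {ι : Type*} [Fintype ι] {a : ι → ℝ}

/-- The joint law of independent gamma(`a i`, 1) variables. -/
noncomputable def gammaPi (a : ι → ℝ) : Measure (ι → ℝ) :=
  Measure.pi fun i => (gammaLaw (a i) : Measure ℝ)

instance : IsProbabilityMeasure (gammaPi a) := by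
  unfold gammaPi
  infer_instance

lemma measurePreserving_eval_gammaPi (ha : ∀ i, 0 < a i) (i : ι) :
    MeasurePreserving (Function.eval i) (gammaPi a) (gammaMeasure (a i) 1) := by
  rw [← gammaLaw_toMeasure (ha i)]
  exact measurePreserving_eval (fun i => (gammaLaw (a i) : Measure ℝ)) i

lemma ae_gammaPi_pos (ha : ∀ i, 0 < a i) : ∀ᵐ g ∂gammaPi a, ∀ i, 0 < g i :=
  ae_all_iff.2 fun i =>
    (measurePreserving_eval_gammaPi ha i).quasiMeasurePreserving.ae (ae_gammaMeasure_pos (a i) 1)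

lemma memLp_eval_gammaPi (ha : ∀ i, 0 < a i) (i : ι) :
    MemLp (fun g : ι → ℝ => g i) 2 (gammaPi a) :=
  (memLp_id_gammaMeasure (ha i)).comp_measurePreserving (measurePreserving_eval_gammaPi ha i)

lemma integral_eval_gammaPi (ha : ∀ i, 0 < a i) (i : ι) : ∫ g, g i ∂gammaPi a = a i := by
  rw [← integral_id_gammaMeasure (ha i), ← (measurePreserving_eval_gammaPi ha i).map_eq,
    integral_map (measurable_pi_apply i).aemeasurable (by fun_prop)]

lemma variance_eval_gammaPi (ha : ∀ i, 0 < a i) (i : ι) :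
    Var[fun g : ι → ℝ => g i; gammaPi a] = a i := by
  rw [← variance_id_gammaMeasure (ha i)]
  exact (measurePreserving_eval_gammaPi ha i).variance_fun_comp (f := id) (by fun_prop)

/-- Chebyshev: by independence the variance of the sum is the sum of the variances, and a gamma(`a`,
1) variable has variance equal to its mean `a`. The set `s` serves as a singleton for the numerator
of a Dirichlet weight and as everything for its denominator. -/
lemma gammaPi_sum_deviation_le (ha : ∀ i, 0 < a i) (s : Finset ι) {c : ℝ} (hc : 0 < c) :
    gammaPi a {g | c ≤ |∑ i ∈ s, g i - ∑ i ∈ s, a i|} ≤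
      ENNReal.ofReal ((∑ i ∈ s, a i) / c ^ 2) := by
  have hsum : (fun g : ι → ℝ => ∑ i ∈ s, g i) = ∑ i ∈ s, fun g : ι → ℝ => g i := by
    ext g
    simp
  have hL : MemLp (fun g : ι → ℝ => ∑ i ∈ s, g i) 2 (gammaPi a) :=
    memLp_finsetSum _ fun i _ => memLp_eval_gammaPi ha i
  have hvar : Var[fun g : ι → ℝ => ∑ i ∈ s, g i; gammaPi a] = ∑ i ∈ s, a i := by
    rw [hsum, IndepFun.variance_sum (fun i _ => memLp_eval_gammaPi ha i)]
    · exact Finset.sum_congr rfl fun i _ => variance_eval_gammaPi ha i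
    · intro i _ j _ hij
      exact (iIndepFun_pi (μ := fun i => (gammaLaw (a i) : Measure ℝ)) (X := fun _ => id)
        (fun _ => aemeasurable_id)).indepFun hij
  have hmean : ∫ g, ∑ i ∈ s, g i ∂gammaPi a = ∑ i ∈ s, a i := by
    rw [integral_finsetSum _ fun i _ => (memLp_eval_gammaPi ha i).integrable one_le_two]
    exact Finset.sum_congr rfl fun i _ => integral_eval_gammaPi ha i
  have h := meas_ge_le_variance_div_sq hL hc
  rwa [hvar, hmean] at h

lemma dirichletLaw_toMeasure (a : ι → ℝ) :
    (dirichletLaw a : Measure (ι → ℝ)) = (gammaPi a).map fun g i => g i / ∑ j, g j := rfl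

lemma ae_dirichletLaw [Nonempty ι] (ha : ∀ i, 0 < a i) :
    ∀ᵐ δ ∂(dirichletLaw a : Measure (ι → ℝ)), (∀ i, 0 ≤ δ i) ∧ ∑ i, δ i = 1 := by
  have hm : MeasurableSet {δ : ι → ℝ | (∀ i, 0 ≤ δ i) ∧ ∑ i, δ i = 1} := by
    refine MeasurableSet.inter ?_ ?_
    · exact (MeasurableSet.iInter fun i => measurableSet_le (f := fun _ : ι → ℝ => (0 : ℝ))
        measurable_const (measurable_pi_apply i)).congr (by ext; simp; rfl)
    · exact measurableSet_eq_fun (by fun_prop) measurable_const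
  rw [dirichletLaw_toMeasure, ae_map_iff (by fun_prop) hm]
  filter_upwards [ae_gammaPi_pos ha] with g hg
  have hpos : 0 < ∑ i, g i := Finset.sum_pos (fun i _ => hg i) Finset.univ_nonempty
  exact ⟨fun i => div_nonneg (hg i).le hpos.le, by rw [← Finset.sum_div, div_self hpos.ne']⟩

/-- A ratio of gamma sums is close to the ratio of the means once numerator and denominator are each
within `ε N / 2` of their means. Each of the two exceptional events has probability at most `N / (ε
N / 2) ^ 2 = 4 / (ε ^ 2 N)`, whence the `8`. -/
lemma dirichletLaw_deviation_le (ha : ∀ i, 0 < a i) (j : ι) {ε : ℝ} (hε : 0 < ε) :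
    (dirichletLaw a : Measure (ι → ℝ)) {δ | ε ≤ |δ j - a j / ∑ i, a i|} ≤
      ENNReal.ofReal (8 / (ε ^ 2 * ∑ i, a i)) := by
  set N := ∑ i, a i with hN
  have hjN : a j ≤ N := Finset.single_le_sum (fun i _ => (ha i).le) (Finset.mem_univ j)
  have hN0 : 0 < N := (ha j).trans_le hjN
  have hc : 0 < ε * N / 2 := by positivity
  have hm : MeasurableSet {δ : ι → ℝ | ε ≤ |δ j - a j / N|} :=
    measurableSet_le measurable_const (by fun_prop)
  rw [dirichletLaw_toMeasure, Measure.map_apply (by fun_prop) hm]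
  have h1 := gammaPi_sum_deviation_le ha Finset.univ hc
  have h2 := gammaPi_sum_deviation_le ha {j} hc
  simp only [Finset.sum_singleton, ← hN] at h1 h2
  have h2' := h2.trans (ENNReal.ofReal_le_ofReal (div_le_div_of_nonneg_right hjN (sq_nonneg _)))
  calc gammaPi a ((fun g i => g i / ∑ j, g j) ⁻¹' {δ | ε ≤ |δ j - a j / N|})
      ≤ gammaPi a ({g | ε * N / 2 ≤ |∑ i, g i - N|} ∪ {g | ε * N / 2 ≤ |g j - a j|}) := by
        refine measure_mono_ae ?_
        filter_upwards [ae_gammaPi_pos ha] with g hg hε'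
        change ε ≤ |g j / ∑ i, g i - a j / N| at hε'
        have hgT : g j ≤ ∑ i, g i :=
          Finset.single_le_sum (fun i _ => (hg i).le) (Finset.mem_univ j)
        set T := ∑ i, g i
        have hT : 0 < T := (hg j).trans_le hgT
        by_contra hcon
        have hcon' : ¬ (ε * N / 2 ≤ |T - N|) ∧ ¬ (ε * N / 2 ≤ |g j - a j|) := not_or.1 hcon
        -- The error of the denominator enters multiplied by `g j / T ≤ 1`, so no lower bound on `T`
        -- beyond positivity is needed.
        have hsplit : g j / T - a j / N = (g j / T * (N - T) + (g j - a j)) / N := by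
          field_simp
          ring
        have hq : |g j / T| ≤ 1 := by
          rw [abs_of_pos (div_pos (hg j) hT)]
          exact (div_le_one hT).2 hgT
        have hq2 : |g j / T * (N - T)| ≤ |T - N| := by
          rw [abs_mul, abs_sub_comm N T]
          exact mul_le_of_le_one_left (abs_nonneg _) hq
        rw [hsplit, abs_div, abs_of_pos hN0, le_div_iff₀ hN0] at hε'
        have := abs_add_le (g j / T * (N - T)) (g j - a j)
        linarith [hcon'.1, hcon'.2]
    _ ≤ ENNReal.ofReal (N / (ε * N / 2) ^ 2) + ENNReal.ofReal (N / (ε * N / 2) ^ 2) :=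
        (measure_union_le _ _).trans (add_le_add h1 h2')
    _ = ENNReal.ofReal (8 / (ε ^ 2 * N)) := by
        rw [← ENNReal.ofReal_add (by positivity) (by positivity)]
        congr 1
        field_simp
        ring

end Gamma

/-! ### Weak convergence to a point mass, and to a discrete law. -/

section Convergence

variable {M : Type*} [TopologicalSpace M] [MeasurableSpace M] [OpensMeasurableSpace M]

lemma tendsto_diracProba_of_forall_nhds {Q : ℕ → ProbabilityMeasure M} {p : M}
    (h : ∀ U ∈ 𝓝 p, Tendsto (fun n => (Q n : Measure M) Uᶜ) atTop (𝓝 0)) :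
    Tendsto Q atTop (𝓝 (diracProba p)) := by
  refine tendsto_of_forall_isOpen_le_liminf' fun G hG => ?_
  by_cases hp : p ∈ G
  · have h1 : Tendsto (fun n => (Q n : Measure M) G) atTop (𝓝 1) := by
      have h2 := ENNReal.Tendsto.sub (tendsto_const_nhds (x := (1 : ℝ≥0∞)))
        (h G (hG.mem_nhds hp)) (Or.inl ENNReal.one_ne_top)
      rw [tsub_zero] at h2
      refine h2.congr fun n => ?_
      rw [← prob_compl_eq_one_sub hG.measurableSet.compl, compl_compl]
    rw [h1.liminf_eq]
    exact prob_le_one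
  · simp [diracProba, hG.measurableSet, hp]

end Convergence

variable {I : Type*} [TopologicalSpace I] [PolishSpace I] [MeasurableSpace I] [BorelSpace I]

/-- Portmanteau: for open `G`, `P₀ G` is the supremum of the finite sums of atoms in `G ∩ S`; each
such sum is the limit of the same sum for `P`, which is at most `P G`. Stated for the coarsest
filter along which all atoms converge; countability of `S` makes it countably generated. -/
lemma iInf_comap_singleton_le_nhds {P₀ : ProbabilityMeasure I} {S : Set I} (hS : S.Countable)
    (hP₀ : (P₀ : Measure I) Sᶜ = 0) :
    ⨅ s : S, comap (fun P : ProbabilityMeasure I => P {(s : I)}) (𝓝 (P₀ {(s : I)})) ≤ 𝓝 P₀ := by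
  have : Countable S := hS.to_subtype
  set L := ⨅ s : S, comap (fun P : ProbabilityMeasure I => P {(s : I)}) (𝓝 (P₀ {(s : I)}))
  have hL : ∀ s : S, Tendsto (fun P : ProbabilityMeasure I => P {(s : I)}) L (𝓝 (P₀ {(s : I)})) :=
    fun s => (tendsto_comap).mono_left (iInf_le _ s)
  have : L.IsCountablyGenerated := inferInstance
  refine tendsto_of_forall_isOpen_le_liminf' (L := L) (μs := fun P => P) fun G hG => ?_
  have hG0 : (P₀ : Measure I) G = ∑' s : ↥(G ∩ S), (P₀ : Measure I) {(s : I)} := by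
    have : (P₀ : Measure I) G = (P₀ : Measure I) (G ∩ S) := by
      refine le_antisymm ?_ (measure_mono Set.inter_subset_left)
      calc (P₀ : Measure I) G ≤ (P₀ : Measure I) (G ∩ S) + (P₀ : Measure I) (G \ S) :=
            measure_le_inter_add_sdiff _ _ _
        _ ≤ (P₀ : Measure I) (G ∩ S) + 0 := by
            gcongr
            exact (measure_mono fun x hx => hx.2).trans hP₀.le
        _ = _ := add_zero _
    have hb := measure_biUnion (μ := (P₀ : Measure I)) (f := fun x : I => {x})
      (hS.mono (Set.inter_subset_right (s := G))) (by
        intro x _ y _ hxy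
        simpa [Function.onFun] using hxy) fun _ _ => measurableSet_singleton _
    rw [this, ← hb, Set.biUnion_of_singleton]
  rw [hG0, ENNReal.tsum_eq_iSup_sum]
  refine iSup_le fun F => ?_
  have hF : Tendsto (fun P : ProbabilityMeasure I => ∑ s ∈ F, (P : Measure I) {(s : I)}) L
      (𝓝 (∑ s ∈ F, (P₀ : Measure I) {(s : I)})) := by
    refine tendsto_finsetSum _ fun s _ => ?_
    have := ENNReal.tendsto_coe.2 (hL ⟨s, s.2.2⟩)
    simpa using this
  by_cases hbot : L.NeBot
  · rw [← hF.liminf_eq]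
    refine liminf_le_liminf (Eventually.of_forall fun P => ?_)
    have : ∑ s ∈ F, (P : Measure I) {(s : I)} = (P : Measure I) (⋃ s ∈ F, {(s : I)}) := by
      rw [measure_biUnion_finset _ fun _ _ => measurableSet_singleton _]
      intro x _ y _ hxy
      simpa [Function.onFun, Subtype.ext_iff] using hxy
    rw [this]
    exact measure_mono (Set.iUnion₂_subset fun s _ => by simpa using s.2.1)
  · rw [not_neBot] at hbot
    simp [hbot]

lemma tendsto_diracProba_of_forall_singleton {P₀ : ProbabilityMeasure I} {S : Set I}
    (hS : S.Countable) (hP₀ : (P₀ : Measure I) Sᶜ = 0)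
    {Q : ℕ → ProbabilityMeasure (ProbabilityMeasure I)}
    (hQ : ∀ s ∈ S, ∀ ε > 0, Tendsto (fun n => (Q n : Measure (ProbabilityMeasure I))
      {P | ε ≤ |(P : Measure I).real {s} - (P₀ : Measure I).real {s}|}) atTop (𝓝 0)) :
    Tendsto Q atTop (𝓝 (diracProba P₀)) := by
  -- Convergence in probability as a filter: `𝓕 ≤ 𝓝 P₀` says that every neighbourhood of `P₀` has `Q
  -- n`-mass tending to one. Convergence of each atom along `𝓕` then gives weak convergence by
  -- comparing filters. Outer-measure monotonicity and subadditivity suffice, so the sets need not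
  -- be measurable.
  let 𝓕 : Filter (ProbabilityMeasure I) :=
    { sets := {W | Tendsto (fun n => (Q n : Measure (ProbabilityMeasure I)) Wᶜ) atTop (𝓝 0)}
      univ_sets := by simp
      sets_of_superset := fun {W V} hW hWV => by
        exact tendsto_of_tendsto_of_tendsto_of_le_of_le tendsto_const_nhds hW
          (fun _ => zero_le) fun n => measure_mono (Set.compl_subset_compl.2 hWV)
      inter_sets := fun {W V} hW hV => by
        have := Tendsto.add hW hV
        rw [add_zero] at this
        refine tendsto_of_tendsto_of_tendsto_of_le_of_le tendsto_const_nhds this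
          (fun _ => zero_le) fun n => ?_
        simp only [Set.compl_inter]
        exact measure_union_le _ _ }
  refine tendsto_diracProba_of_forall_nhds fun U hU => ?_
  suffices 𝓕 ≤ 𝓝 P₀ from this hU
  refine le_trans (le_iInf fun s => ?_) (iInf_comap_singleton_le_nhds hS hP₀)
  rw [← tendsto_iff_comap, Metric.tendsto_nhds]
  intro ε hε
  have := hQ s s.2 ε hε
  change Tendsto _ _ _
  refine this.congr fun n => ?_
  congr 1
  ext P
  simp [NNReal.dist_eq, measureReal_def, ProbabilityMeasure.coeFn_def, ENNReal.toReal]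

/-! ### Counting observations, and the law of large numbers for frequencies. -/

lemma sum_multiplicity {I : Type*} (x : ℕ → I) (n : ℕ) :
    ∑ y ∈ distinctValues x n, multiplicity x n y = n := by
  classical
  have := Finset.card_eq_sum_card_image x (Finset.range n)
  rw [Finset.card_range] at this
  unfold distinctValues multiplicity
  convert this.symm

lemma mem_distinctValues_iff {I : Type*} {x : ℕ → I} {n : ℕ} {y : I} :
    y ∈ distinctValues x n ↔ 0 < multiplicity x n y := by
  classical
  simp [distinctValues, multiplicity, Finset.card_pos, Finset.Nonempty]

lemma numDistinct_le {I : Type*} (x : ℕ → I) (n : ℕ) : numDistinct x n ≤ n := by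
  classical
  simpa [numDistinct, distinctValues] using Finset.card_image_le (s := Finset.range n) (f := x)

lemma numDistinct_pos {I : Type*} (x : ℕ → I) {n : ℕ} (hn : 0 < n) : 0 < numDistinct x n := by
  classical
  simp [numDistinct, distinctValues, Finset.card_pos, hn.ne']

lemma ae_tendsto_multiplicity_div {I : Type*} [MeasurableSpace I] [MeasurableSingletonClass I]
    (P₀ : ProbabilityMeasure I) (s : I) :
    ∀ᵐ x ∂(iidLaw P₀ : Measure (ℕ → I)),
      Tendsto (fun n : ℕ => (multiplicity x n s : ℝ) / n) atTop (𝓝 ((P₀ : Measure I).real {s})) := by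
  classical
  let f : I → ℝ := Set.indicator {s} 1
  have hf : Measurable f := measurable_one.indicator (measurableSet_singleton s)
  have hid : ∀ i, MeasurePreserving (Function.eval i) (iidLaw P₀ : Measure (ℕ → I)) P₀ := fun i =>
    measurePreserving_eval_infinitePi (fun _ => (P₀ : Measure I)) i
  have hmean : ∫ x, f (x 0) ∂(iidLaw P₀ : Measure (ℕ → I)) = (P₀ : Measure I).real {s} := by
    rw [← integral_indicator_one (measurableSet_singleton s), ← (hid 0).map_eq,
      integral_map (measurable_pi_apply 0).aemeasurable hf.aestronglyMeasurable]
  have h := strong_law_ae_real (μ := (iidLaw P₀ : Measure (ℕ → I))) (fun i x => f (x i))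
    ((integrable_const (1 : ℝ))
      |>.mono' (hf.comp (measurable_pi_apply 0)).aestronglyMeasurable (ae_of_all _ fun x => by
      by_cases h : x 0 = s <;> simp [f, h]))
    (fun i j hij =>
      (iIndepFun_infinitePi (P := fun _ : ℕ => (P₀ : Measure I)) (fun _ => hf)).indepFun hij)
    (fun i => by
      have hi : ∀ i, IdentDistrib (fun x : ℕ → I => x i) id (iidLaw P₀ : Measure (ℕ → I)) P₀ :=
        fun i => ⟨(measurable_pi_apply i).aemeasurable, aemeasurable_id,
          by rw [Measure.map_id]; exact (hid i).map_eq⟩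
      exact ((hi i).trans (hi 0).symm).comp hf)
  rw [hmean] at h
  filter_upwards [h] with x hx
  refine hx.congr fun n => ?_
  congr 1
  rw [multiplicity, Finset.card_filter]
  push_cast
  exact Finset.sum_congr rfl fun i _ => by by_cases h : x i = s <;> simp [f, h]

/-! ### Concentration of the posterior mass of a single point. -/

section Posterior

variable {I : Type*} [MeasurableSpace I]

lemma atomic_singleton [MeasurableSingletonClass I] (Y : Finset I) (δ : Y → ℝ) (s : I) :
    atomic δ (fun y : Y => (y : I)) {s} =
      open Classical in ENNReal.ofReal (if h : s ∈ Y then δ ⟨s, h⟩ else 0) := by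
  classical
  rw [atomic, Measure.sum_apply _ (measurableSet_singleton s), tsum_fintype]
  simp only [Measure.smul_apply, smul_eq_mul, Measure.dirac_apply' _ (measurableSet_singleton s)]
  split_ifs with h
  · rw [Finset.sum_eq_single_of_mem ⟨s, h⟩ (Finset.mem_univ _)]
    · simp
    · intro y _ hy
      have : (y : I) ≠ s := fun hys => hy (Subtype.ext hys)
      simp [this]
  · rw [ENNReal.ofReal_zero]
    refine Finset.sum_eq_zero fun y _ => ?_
    have : (y : I) ≠ s := fun hys => h (hys ▸ y.2)
    simp [this]

lemma isProbabilityMeasure_atomic {κ : Type*} [Fintype κ] {δ : κ → ℝ} (h0 : ∀ i, 0 ≤ δ i)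
    (h1 : ∑ i, δ i = 1) (z : κ → I) : IsProbabilityMeasure (atomic δ z) := by
  constructor
  rw [atomic, Measure.sum_apply _ MeasurableSet.univ, tsum_fintype]
  simp [← ENNReal.ofReal_sum_of_nonneg fun i _ => h0 i, h1]

lemma toProb_eq (H : ProbabilityMeasure I) (μ : Measure I) [h : IsProbabilityMeasure μ] :
    (toProb H μ : Measure I) = μ := by
  simp [toProb, h]

lemma posteriorMeasure_real_singleton [MeasurableSingletonClass I] (H P : ProbabilityMeasure I)
    (Y : Finset I) {r : ℝ} {δ : Y → ℝ} (hr0 : 0 ≤ r) (hr1 : r ≤ 1) (h0 : ∀ y, 0 ≤ δ y)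
    (h1 : ∑ y, δ y = 1) (s : I) :
    (posteriorMeasure H Y (P, r, δ) : Measure I).real {s} =
      open Classical in
      r * (P : Measure I).real {s} + (1 - r) * (if h : s ∈ Y then δ ⟨s, h⟩ else 0) := by
  classical
  have := isProbabilityMeasure_atomic h0 h1 (fun y : Y => (y : I))
  have : IsProbabilityMeasure (ENNReal.ofReal r • (P : Measure I) +
      ENNReal.ofReal (1 - r) • atomic δ (fun y : Y => (y : I))) := by
    constructor
    simp [← ENNReal.ofReal_add hr0 (sub_nonneg.2 hr1)]
  have hδ : 0 ≤ (if h : s ∈ Y then δ ⟨s, h⟩ else 0) := by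
    split_ifs with h
    exacts [h0 _, le_rfl]
  rw [posteriorMeasure, toProb_eq, measureReal_def, Measure.add_apply, Measure.smul_apply,
    Measure.smul_apply, atomic_singleton, smul_eq_mul, smul_eq_mul, ENNReal.toReal_add
      (by finiteness) (by finiteness), ENNReal.toReal_mul, ENNReal.toReal_mul,
    ENNReal.toReal_ofReal hr0, ENNReal.toReal_ofReal (sub_nonneg.2 hr1), ENNReal.toReal_ofReal hδ,
    measureReal_def]

open Classical in
/-- The mean of the Dirichlet weight of `s` in the posterior law: `(e_s - α) / (n - m α)` if `s` has
been observed, and zero otherwise. -/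
noncomputable def discountedFrequency (α : ℝ) (x : ℕ → I) (n : ℕ) (s : I) : ℝ :=
  (if s ∈ distinctValues x n then (multiplicity x n s : ℝ) - α else 0) / (n - numDistinct x n * α)

lemma measurable_real_singleton [MeasurableSingletonClass I] (s : I) :
    Measurable fun P : ProbabilityMeasure I => (P : Measure I).real {s} :=
  ((Measure.measurable_coe (measurableSet_singleton s)).comp
    measurable_subtype_coe).ennreal_toReal

lemma sum_multiplicity_sub {I : Type*} (α : ℝ) (x : ℕ → I) (n : ℕ) :
    ∑ y : distinctValues x n, ((multiplicity x n y : ℝ) - α) = n - numDistinct x n * α := by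
  rw [Finset.sum_coe_sort (distinctValues x n) fun y => (multiplicity x n y : ℝ) - α,
    Finset.sum_sub_distrib, ← Nat.cast_sum, sum_multiplicity, Finset.sum_const, nsmul_eq_mul,
    numDistinct]

lemma multiplicity_sub_pos {I : Type*} {α : ℝ} (hα₁ : α < 1) {x : ℕ → I} {n : ℕ} {y : I}
    (hy : y ∈ distinctValues x n) : 0 < (multiplicity x n y : ℝ) - α := by
  have : (1 : ℝ) ≤ multiplicity x n y := by exact_mod_cast mem_distinctValues_iff.1 hy
  linarith

/-- With `w` the Dirichlet weight of `s` and `c` its centre, `P {s} - c = r (P' {s} - w) + (w - c)`,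
where the first term is at most `r` in absolute value. A deviation of `ε` forces `ε / 2 ≤ r`
(Markov) or `ε / 2 ≤ |w - c|` (the Dirichlet bound). -/
lemma posterior_deviation_le [MeasurableSingletonClass I] (H : ProbabilityMeasure I) {α θ : ℝ}
    (hα₀ : 0 ≤ α) (hα₁ : α < 1) (hθ : -α < θ) (x : ℕ → I) {n : ℕ} (hn : 0 < n) (s : I) {ε : ℝ}
    (hε : 0 < ε) :
    (posterior H α θ x n : Measure (ProbabilityMeasure I))
        {P | ε ≤ |(P : Measure I).real {s} - discountedFrequency α x n s|} ≤
      ENNReal.ofReal ((θ + numDistinct x n * α) / (θ + n) / (ε / 2)) +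
        ENNReal.ofReal (8 / ((ε / 2) ^ 2 * (n - numDistinct x n * α))) := by
  classical
  set Y := distinctValues x n with hY
  set m : ℝ := (numDistinct x n : ℝ)
  set c := discountedFrequency α x n s with hc
  -- Here `0 < n` matters: `m ≥ 1` gives `θ + m α ≥ θ + α > 0`, and `m ≤ n` with `α < 1` gives `n -
  -- m α > 0`, so the beta law is not the default point mass.
  have hm1 : (1 : ℝ) ≤ m := Nat.one_le_cast.2 (numDistinct_pos x hn)
  have hmn : m ≤ n := Nat.cast_le.2 (numDistinct_le x n)
  have hA : 0 < θ + m * α := by nlinarith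
  have hB : 0 < n - m * α := by nlinarith
  have ha : ∀ y : Y, 0 < (multiplicity x n y : ℝ) - α := fun y => multiplicity_sub_pos hα₁ y.2
  have hne : Nonempty Y := ⟨x 0, by
    rw [hY, distinctValues]
    exact Finset.mem_image_of_mem x (Finset.mem_range.2 hn)⟩
  -- For unobserved `s` both `w` and `c` are zero, and the second deviation event is empty.
  let w : (Y → ℝ) → ℝ := fun δ => if h : s ∈ Y then δ ⟨s, h⟩ else 0
  have hw : Measurable w := by
    by_cases h : s ∈ Y
    · simpa only [w, h, dif_pos] using measurable_pi_apply _
    · simpa only [w, h, dif_neg, not_false_iff] using measurable_const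
  set ρ : Measure ℝ := (betaLaw (θ + m * α) (n - m * α) : Measure ℝ) with hρ
  set D : Measure (Y → ℝ) :=
    (dirichletLaw fun y : Y => (multiplicity x n y : ℝ) - α : Measure (Y → ℝ))
  set κ : Measure (ProbabilityMeasure I) :=
    (pdLaw H α (θ + m * α) : Measure (ProbabilityMeasure I))
  have hE : MeasurableSet {P : ProbabilityMeasure I | ε ≤ |(P : Measure I).real {s} - c|} :=
    measurableSet_le measurable_const ((measurable_real_singleton s).sub_const c).abs
  have hE₁ : MeasurableSet {r : ℝ | ε / 2 ≤ r} := measurableSet_le measurable_const measurable_id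
  have hE₂ : MeasurableSet {δ : Y → ℝ | ε / 2 ≤ |w δ - c|} :=
    measurableSet_le measurable_const (hw.sub_const c).abs
  have hD₂ : D {δ | ε / 2 ≤ |w δ - c|} ≤ ENNReal.ofReal (8 / ((ε / 2) ^ 2 * (n - m * α))) := by
    by_cases h : s ∈ Y
    · have := dirichletLaw_deviation_le ha ⟨s, h⟩ (half_pos hε)
      rw [sum_multiplicity_sub] at this
      have hwc : ∀ δ, w δ - c = δ ⟨s, h⟩ - ((multiplicity x n s : ℝ) - α) / (n - m * α) :=
        fun δ => congrArg₂ _ (dif_pos h) (congrArg (· / (n - m * α)) (if_pos h))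
      simpa only [hwc] using this
    · have : {δ : Y → ℝ | ε / 2 ≤ |w δ - c|} = ∅ := by
        ext δ
        have hs : s ∉ distinctValues x n := h
        simp [w, h, hc, discountedFrequency, hs, hε]
      simp [this]
  have hmap : (posterior H α θ x n : Measure (ProbabilityMeasure I)) =
      (κ.prod (ρ.prod D)).map (posteriorMeasure H Y) := rfl
  have hpρ : MeasurePreserving (fun q : ProbabilityMeasure I × ℝ × (Y → ℝ) => q.2.1)
      (κ.prod (ρ.prod D)) ρ := measurePreserving_fst.comp measurePreserving_snd
  have hpD : MeasurePreserving (fun q : ProbabilityMeasure I × ℝ × (Y → ℝ) => q.2.2)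
      (κ.prod (ρ.prod D)) D := measurePreserving_snd.comp measurePreserving_snd
  have haeρ : ∀ᵐ q ∂κ.prod (ρ.prod D), 0 < q.2.1 ∧ q.2.1 < 1 := by
    refine hpρ.quasiMeasurePreserving.ae (p := fun r => 0 < r ∧ r < 1) ?_
    rw [hρ, betaLaw_toMeasure hA hB]
    exact ae_betaMeasure _ _
  have haeD : ∀ᵐ q ∂κ.prod (ρ.prod D), (∀ y, 0 ≤ q.2.2 y) ∧ ∑ y, q.2.2 y = 1 :=
    hpD.quasiMeasurePreserving.ae (ae_dirichletLaw ha)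
  rw [hmap, Measure.map_apply (measurable_posteriorMeasure H Y) hE]
  calc (κ.prod (ρ.prod D)) (posteriorMeasure H Y ⁻¹' {P | ε ≤ |(P : Measure I).real {s} - c|})
      ≤ (κ.prod (ρ.prod D)) ((fun q => q.2.1) ⁻¹' {r | ε / 2 ≤ r} ∪
          (fun q => q.2.2) ⁻¹' {δ | ε / 2 ≤ |w δ - c|}) := by
        refine measure_mono_ae ?_
        filter_upwards [haeρ, haeD] with ⟨P, r, δ⟩ hr hδ hdev
        change ε ≤ |(posteriorMeasure H Y (P, r, δ) : Measure I).real {s} - c| at hdev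
        rw [posteriorMeasure_real_singleton H P Y hr.1.le hr.2.le hδ.1 hδ.2] at hdev
        by_contra hcon
        have hcon' : ¬ (ε / 2 ≤ r) ∧ ¬ (ε / 2 ≤ |w δ - c|) := not_or.1 hcon
        have hw0 : 0 ≤ w δ := by
          by_cases h : s ∈ Y
          · simpa only [w, h, dif_pos] using hδ.1 _
          · simp [w, h]
        have hw1 : w δ ≤ 1 := by
          by_cases h : s ∈ Y
          · simp only [w, h, dif_pos]
            exact (Finset.single_le_sum (fun y _ => hδ.1 y) (Finset.mem_univ _)).trans hδ.2.le
          · simp [w, h]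
        change ε ≤ |r * (P : Measure I).real {s} + (1 - r) * w δ - c| at hdev
        have hsplit : r * (P : Measure I).real {s} + (1 - r) * w δ - c =
            r * ((P : Measure I).real {s} - w δ) + (w δ - c) := by ring
        have hP : |(P : Measure I).real {s} - w δ| ≤ 1 := by
          have h0 : 0 ≤ (P : Measure I).real {s} := measureReal_nonneg
          have h1 : (P : Measure I).real {s} ≤ 1 := measureReal_le_one
          rw [abs_le]
          constructor <;> linarith
        have hrP : |r * ((P : Measure I).real {s} - w δ)| ≤ r := by
          rw [abs_mul, abs_of_pos hr.1]
          exact mul_le_of_le_one_right hr.1.le hP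
        rw [hsplit] at hdev
        have := abs_add_le (r * ((P : Measure I).real {s} - w δ)) (w δ - c)
        linarith [hcon'.1, hcon'.2]
    _ ≤ ρ {r | ε / 2 ≤ r} + D {δ | ε / 2 ≤ |w δ - c|} := by
        refine (measure_union_le _ _).trans_eq ?_
        rw [hpρ.measure_preimage hE₁.nullMeasurableSet, hpD.measure_preimage hE₂.nullMeasurableSet]
    _ ≤ _ := by
        refine add_le_add ?_ hD₂
        have := betaLaw_ge_le hA hB (half_pos hε)
        rwa [show θ + m * α + (n - m * α) = θ + n by ring] at this

lemma tendsto_discountedFrequency {I : Type*} {α : ℝ} (hα₀ : 0 ≤ α) (hα₁ : α < 1) {x : ℕ → I}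
    {s : I} {p : ℝ}
    (hx : Tendsto (fun n : ℕ => (numDistinct x n : ℝ) / n) atTop (𝓝 0))
    (hs : Tendsto (fun n : ℕ => (multiplicity x n s : ℝ) / n) atTop (𝓝 p)) :
    Tendsto (fun n : ℕ => discountedFrequency α x n s) atTop (𝓝 p) := by
  classical
  let b : ℕ → ℝ := fun n => if s ∈ distinctValues x n then (multiplicity x n s : ℝ) - α else 0
  have hb : Tendsto (fun n : ℕ => b n / n) atTop (𝓝 p) := by
    -- The discount lowers the count by at most `α < 1`, so the numerator is squeezed between `e_s -
    -- 1` and `e_s`.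
    have hlow : Tendsto (fun n : ℕ => (multiplicity x n s : ℝ) / n - 1 / n) atTop (𝓝 p) := by
      simpa using hs.sub tendsto_one_div_atTop_nhds_zero_nat
    refine tendsto_of_tendsto_of_tendsto_of_le_of_le hlow hs (fun n => ?_) (fun n => ?_)
    · change _ - _ ≤ _
      rw [← sub_div]
      gcongr
      by_cases h : s ∈ distinctValues x n
      · simp only [b, h, if_true]
        linarith
      · have : multiplicity x n s = 0 := by
          simpa using mt mem_distinctValues_iff.2 h
        simp [b, h, this]
    · change _ / _ ≤ _ / _
      gcongr
      by_cases h : s ∈ distinctValues x n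
      · simp only [b, h, if_true]
        linarith
      · simp [b, h]
  have hN : Tendsto (fun n : ℕ => 1 - (numDistinct x n : ℝ) / n * α) atTop (𝓝 1) := by
    simpa using tendsto_const_nhds.sub (hx.mul_const α)
  have := hb.div hN one_ne_zero
  rw [div_one] at this
  refine this.congr' ?_
  filter_upwards [eventually_gt_atTop 0] with n hn
  have : (n : ℝ) ≠ 0 := by positivity
  change b n / n / _ = b n / _
  rw [div_div]
  congr 1
  field_simp

lemma tendsto_posterior_deviation [MeasurableSingletonClass I] (H : ProbabilityMeasure I)
    {α θ : ℝ} (hα₀ : 0 ≤ α) (hα₁ : α < 1) (hθ : -α < θ) {x : ℕ → I} {s : I} {p : ℝ}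
    (hx : Tendsto (fun n : ℕ => (numDistinct x n : ℝ) / n) atTop (𝓝 0))
    (hs : Tendsto (fun n : ℕ => (multiplicity x n s : ℝ) / n) atTop (𝓝 p)) {ε : ℝ} (hε : 0 < ε) :
    Tendsto (fun n => (posterior H α θ x n : Measure (ProbabilityMeasure I))
      {P | ε ≤ |(P : Measure I).real {s} - p|}) atTop (𝓝 0) := by
  have hn : Tendsto (fun n : ℕ => (n : ℝ)) atTop atTop := tendsto_natCast_atTop_atTop
  have hε2 := half_pos hε
  -- One half of `ε` pays for replacing `p` by the discounted frequency; the other is halved again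
  -- in `posterior_deviation_le`.
  have hR : Tendsto (fun n : ℕ => (θ + numDistinct x n * α) / (θ + n) / (ε / 2 / 2))
      atTop (𝓝 0) := by
    have h1 : Tendsto (fun n : ℕ => θ / n + (numDistinct x n : ℝ) / n * α) atTop (𝓝 0) := by
      simpa using (hn.const_div_atTop θ).add (hx.mul_const α)
    have h2 : Tendsto (fun n : ℕ => θ / n + 1) atTop (𝓝 1) := by
      simpa using (hn.const_div_atTop θ).add_const 1
    have h3 := (h1.div h2 one_ne_zero).div_const (ε / 2 / 2)
    rw [zero_div, zero_div] at h3
    refine h3.congr' ?_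
    filter_upwards [eventually_gt_atTop 0] with n hn
    have : (n : ℝ) ≠ 0 := by positivity
    congr 1
    change (θ / n + (numDistinct x n : ℝ) / n * α) / (θ / n + 1) = _
    rw [show θ / n + (numDistinct x n : ℝ) / n * α = (θ + numDistinct x n * α) / n by ring,
      show θ / n + 1 = (θ + n) / n by field_simp, div_div_div_cancel_right₀ this]
  have hN : Tendsto (fun n : ℕ => (n : ℝ) - numDistinct x n * α) atTop atTop := by
    refine tendsto_atTop_mono (fun n => ?_) (hn.atTop_mul_const (sub_pos.2 hα₁))
    have : (numDistinct x n : ℝ) ≤ n := by exact_mod_cast numDistinct_le x n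
    nlinarith
  have hD : Tendsto (fun n : ℕ => 8 / ((ε / 2 / 2) ^ 2 * (n - numDistinct x n * α)))
      atTop (𝓝 0) :=
    (hN.const_mul_atTop (by positivity)).const_div_atTop 8
  have hsum := (ENNReal.tendsto_ofReal hR).add (ENNReal.tendsto_ofReal hD)
  rw [ENNReal.ofReal_zero, add_zero] at hsum
  refine tendsto_of_tendsto_of_tendsto_of_le_of_le' tendsto_const_nhds hsum
    (Eventually.of_forall fun _ => zero_le) ?_
  have hclose := Metric.tendsto_nhds.1 (tendsto_discountedFrequency hα₀ hα₁ hx hs) _ hε2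
  filter_upwards [eventually_gt_atTop 0, hclose] with n hn hdist
  refine le_trans (measure_mono fun P hP => ?_)
    (posterior_deviation_le H hα₀ hα₁ hθ x hn s hε2)
  change ε / 2 ≤ _
  have hP' : ε ≤ |(P : Measure I).real {s} - p| := hP
  rw [Real.dist_eq] at hdist
  have := abs_sub_le ((P : Measure I).real {s}) (discountedFrequency α x n s) p
  linarith

end Posterior

end PoissonDirichlet

theorem proposition2p2 {I : Type*} [TopologicalSpace I] [PolishSpace I] [MeasurableSpace I]
    [BorelSpace I] (H P₀ : ProbabilityMeasure I) (hH : ∀ z : I, (H : Measure I) {z} = 0)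
    (hdiscrete : ∃ S : Set I, S.Countable ∧ (P₀ : Measure I) Sᶜ = 0)
    (hdistinct : ∀ᵐ x ∂(PoissonDirichlet.iidLaw P₀ : Measure (ℕ → I)),
      Tendsto (fun n : ℕ => (PoissonDirichlet.numDistinct x n : ℝ) / n) atTop (𝓝 0))
    (α θ : ℝ) (hα₀ : 0 ≤ α) (hα₁ : α < 1) (hθ : -α < θ) :
    ∀ᵐ x ∂(PoissonDirichlet.iidLaw P₀ : Measure (ℕ → I)),
      Tendsto (fun n : ℕ => PoissonDirichlet.posterior H α θ x n) atTop (𝓝 (diracProba P₀)) := by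
  obtain ⟨S, hS, hP₀⟩ := hdiscrete
  -- Countability of `S` allows a single null set for all points.
  have hfreq : ∀ᵐ x ∂(PoissonDirichlet.iidLaw P₀ : Measure (ℕ → I)), ∀ s ∈ S,
      Tendsto (fun n : ℕ => (PoissonDirichlet.multiplicity x n s : ℝ) / n) atTop
        (𝓝 ((P₀ : Measure I).real {s})) :=
    (ae_ball_iff hS).2 fun s _ => PoissonDirichlet.ae_tendsto_multiplicity_div P₀ s
  filter_upwards [hdistinct, hfreq] with x hx hxS
  exact PoissonDirichlet.tendsto_diracProba_of_forall_singleton hS hP₀ fun s hs ε hε =>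
    PoissonDirichlet.tendsto_posterior_deviation H hα₀ hα₁ hθ hx (hxS s hs) hε
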